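/- **Notation.** For a set $X$ let $\beta X$ be the set of ultrafilters over $X$ with its standard compact Hausdorff topology (basic open sets $\{\mathfrak u: A\in\mathfrak u\}$, $A\subseteq X$); points of $X$ are identified with principal ultrafilters. Write $(\forall^{\mathfrak u}x)\,\varphi(x)$ for $\{x:\varphi(x)\}\in\mathfrak u$. For $F:X^n\to X$ and $R\subseteq X^n$ let $$\widetilde F(\mathfrak u_1,\ldots,\mathfrak u_n)=\{S\subseteq X:(\forall^{\mathfrak u_1}x_1)\cdots(\forall^{\mathfrak u_n}x_n)\;F(x_1,\ldots,x_n)\in S\},$$ $$\widetilde R(\mathfrak u_1,\ldots,\mathfrak u_n)\iff(\forall^{\mathfrak u_1}x_1)\cdots(\forall^{\mathfrak u_n}x_n)\;R(x_1,\ldots,x_n),$$ $$R^*(\mathfrak u_1,\ldots,\mathfrak u_n)\iff \text{every } A_1\times\cdots\times A_n \text{ with } A_i\in\mathfrak u_i \text{ meets } R.$$ For a first-order model $\mathfrak A=(X,F,\ldots,R,\ldots)$ let $\widetilde{\mathfrak A}=(\beta X,\widetilde F,\ldots,\widetilde R,\ldots)$ and $\mathfrak A^*=(\beta X,\widetilde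 F,\ldots,R^*,\ldots)$. For a map $h$ of $X$ into a compact Hausdorff space $Y$, $\widetilde h:\beta X\to Y$ is its continuous extension, and $h``X$ is the image of $h$. **Generalized models.** An ultrafilter interpretation over a set $M$ takes each $n$-ary function symbol to an ultrafilter over the set $M^{M^n}$ of $n$-ary operations on $M$, and each $n$-ary predicate symbol to an ultrafilter over $\mathcal P(M^n)$. A *generalized model (in the wide sense)* with universe $M$ is an ultrafilter interpretation over $M$. A *generalized model in the narrow sense* with universe $\beta X$ is an ultrafilter interpretation over $X$. If spaces of operations and of relations on $M$ are fixed (for each $n$, topologies on $M^{M^n}$ and $\mathcal P(M^n)$ together with subspaces in which limits are taken), and each ultrafilter interpreting a symbol in $\mathfrak V$ converges to a unique point of the corresponding subspace, its *limit*, then the ordinary model $\lim\mathfrak V$ with universe $M$ interprets the symbols by these limits. A map is a *homomorphism* of $\mathfrak U$ into $\mathfrak V$ iff $\lim\mathfrak U$ and $\lim\mathfrak V$ exist and it is a homomorphism of $\lim\mathfrak U$ into $\lim\mathfrak V$. An ordinary model is regarded as the generalized model that interprets each symbol by the corresponding principal ultrafilter, and it is the limit of this generalized model. Let $\mathfrak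 B$ be a generalized model in the narrow sense with universe $\beta X$. It is *pseudo-principal on function symbols* iff for each $n$-ary function symbol, interpreted by $\mathfrak f$, and all $a_1,\ldots,a_n\in X$, the ultrafilter $\{S\subseteq X:(\forall^{\mathfrak f}f)\,f(a_1,\ldots,a_n)\in S\}$ is principal. In that case its *principal submodel* is the ordinary model $\mathfrak A$ with universe $X$ in which the value of this symbol at $(a_1,\ldots,a_n)$ is the point generating that ultrafilter, and a predicate symbol interpreted in $\mathfrak B$ by $\mathfrak r$ holds at $(a_1,\ldots,a_n)$ iff $(\forall^{\mathfrak r}R)\,R(a_1,\ldots,a_n)$. The generalized model $I(\mathfrak B)$ with universe $\beta X$ interprets a function symbol by the ultrafilter generated by the sets $\{\widetilde f:f\in A\}$, $A\in\mathfrak f$, and a predicate symbol by the ultrafilter generated by the sets $\{R^*:R\in A\}$, $A\in\mathfrak r$. Limits for $I(\mathfrak B)$ are taken in the set of $n$-ary operations on $\beta X$ right continuous w.r.t. $X$, with the topology of pointwise convergence on $X^n$, and in the set of regular closed subsets of $(\beta X)^n$, with the topology transferred from $2^{X^n}$ by the bijection $R\mapsto R^*$. For a topological space $Y$ and $D\subseteq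 Y$, a map $G:Y^n\to Y$ is *right continuous w.r.t. $D$* iff for each $1\le i\le n$, $d_1,\ldots,d_{i-1}\in D$ and $y_{i+1},\ldots,y_n\in Y$ the map $y\mapsto G(d_1,\ldots,d_{i-1},y,y_{i+1},\ldots,y_n)$ is continuous. **Theorem.** Let $\mathfrak U$ and $\mathfrak V$ be generalized models (in the wide sense) in the same signature with universes $\beta X$ and $Y$, respectively, where $Y$ carries a compact Hausdorff topology and spaces of operations and of relations on $Y$ are fixed, and let $h:X\to Y$. Suppose that (a) $\mathfrak U=I(\mathfrak B)$ for a generalized model $\mathfrak B$ in the narrow sense which is pseudo-principal on function symbols, with $\mathfrak A$ its principal submodel; (b) in $\mathfrak V$, every $n$-ary function symbol is interpreted by an ultrafilter having a limit that is an operation $Y^n\to Y$ right continuous w.r.t. $h``X$, and every $n$-ary predicate symbol is interpreted by an ultrafilter having a limit that is a closed subset of $Y^n$ in the product topology. Then the following are equivalent: (i) $h$ is a homomorphism of $\mathfrak A$ into $\mathfrak V$; (ii) $\widetilde h$ is a homomorphism of $\mathfrak U$ into $\mathfrak V$; (iii) $\widetilde h$ is a homomorphism of $\widetilde{\mathfrak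 A}$ into $\mathfrak V$; (iv) $\widetilde h$ is a homomorphism of $\mathfrak A^*$ into $\mathfrak V$. -/

import Mathlib

open Set Filter Topology
open FirstOrder

universe u v

namespace UltraModel

noncomputable section

/-! ## Ultrafilter extensions of maps and relations

`Ultrafilter X` is the set `βX` of ultrafilters over `X`, with Mathlib's instance of the standard
topology, generated by the sets `{𝔲 | A ∈ 𝔲}`. A point `x : X` is identified with the principal
ultrafilter `pure x`. -/

/-- The ultrafilter over `X ^ n` given by the iterated ultrafilter quantifiers
`(∀^{𝔲₁} x₁) ⋯ (∀^{𝔲ₙ} xₙ)`, see `mem_tensor_zero` and `mem_tensor_succ`. -/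
def tensor {X : Type u} : {n : ℕ} → (Fin n → Ultrafilter X) → Ultrafilter (Fin n → X)
  | 0, _ => pure Fin.elim0
  | _ + 1, 𝔲 => (𝔲 0).bind fun x => (tensor (Fin.tail 𝔲)).map fun y => Fin.cons x y

theorem mem_tensor_zero {X : Type u} (𝔲 : Fin 0 → Ultrafilter X) (A : Set (Fin 0 → X)) :
    A ∈ tensor 𝔲 ↔ (Fin.elim0 : Fin 0 → X) ∈ A :=
  Iff.rfl

theorem mem_tensor_succ {X : Type u} {n : ℕ} (𝔲 : Fin (n + 1) → Ultrafilter X)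
    (A : Set (Fin (n + 1) → X)) :
    A ∈ tensor 𝔲 ↔
      {x : X | {y : Fin n → X | (Fin.cons x y : Fin (n + 1) → X) ∈ A} ∈ tensor (Fin.tail 𝔲)}
        ∈ 𝔲 0 :=
  Iff.rfl

/-- The extension `F̃` of an `n`-ary operation `F`:
`S ∈ F̃(𝔲₁, …, 𝔲ₙ)` iff `(∀^{𝔲₁} x₁) ⋯ (∀^{𝔲ₙ} xₙ) F(x₁, …, xₙ) ∈ S`. -/
def extMap {X : Type u} {n : ℕ} (F : (Fin n → X) → X) (𝔲 : Fin n → Ultrafilter X) :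
    Ultrafilter X :=
  (tensor 𝔲).map F

/-- The smaller extension `R̃` of an `n`-ary relation `R`:
`R̃(𝔲₁, …, 𝔲ₙ)` iff `(∀^{𝔲₁} x₁) ⋯ (∀^{𝔲ₙ} xₙ) R(x₁, …, xₙ)`. -/
def extRel {X : Type u} {n : ℕ} (R : Set (Fin n → X)) : Set (Fin n → Ultrafilter X) :=
  {𝔲 | R ∈ tensor 𝔲}

/-- The larger extension `R*` of an `n`-ary relation `R`: `R*(𝔲₁, …, 𝔲ₙ)` iff every product
`A₁ × ⋯ × Aₙ` with `A₁ ∈ 𝔲₁, …, Aₙ ∈ 𝔲ₙ` meets `R`. -/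
def starRel {X : Type u} {n : ℕ} (R : Set (Fin n → X)) : Set (Fin n → Ultrafilter X) :=
  {𝔲 | ∀ A : Fin n → Set X, (∀ i, A i ∈ 𝔲 i) → ∃ x ∈ R, ∀ i, x i ∈ A i}

/-- The ultrafilter extension `𝔄̃ = (βX, F̃, …, R̃, …)` of a model `𝔄 = (X, F, …, R, …)`. -/
abbrev tildeModel {L : Language} {X : Type u} (𝔄 : L.Structure X) : L.Structure (Ultrafilter X) where
  funMap f := extMap (𝔄.funMap f)
  RelMap R 𝔲 := 𝔲 ∈ extRel {x | 𝔄.RelMap R x}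

/-- The ultrafilter extension `𝔄* = (βX, F̃, …, R*, …)` of a model `𝔄 = (X, F, …, R, …)`. -/
abbrev starModel {L : Language} {X : Type u} (𝔄 : L.Structure X) : L.Structure (Ultrafilter X) where
  funMap f := extMap (𝔄.funMap f)
  RelMap R 𝔲 := 𝔲 ∈ starRel {x | 𝔄.RelMap R x}

/-! ## Generalized models -/

/-- An ultrafilter interpretation of the signature `L` over the set `M`: each `n`-ary function
symbol is taken to an ultrafilter over the `n`-ary operations on `M`, each `n`-ary predicate
symbol to an ultrafilter over the `n`-ary relations on `M`.

A generalized model in the wide sense with the universe `M` is an ultrafilter interpretation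
over `M`. A generalized model in the narrow sense with the universe `βX` is an ultrafilter
interpretation over `X`. -/
structure UltraInterp (L : Language) (M : Type u) where
  funUlt : ∀ {n : ℕ}, L.Functions n → Ultrafilter ((Fin n → M) → M)
  relUlt : ∀ {n : ℕ}, L.Relations n → Ultrafilter (Set (Fin n → M))

/-- The extension to ultrafilters of the application operation `app(x₁, …, xₙ, f) = f(x₁, …, xₙ)`:
`S ∈ app̃(𝔲₁, …, 𝔲ₙ, 𝔣)` iff `(∀^{𝔲₁} x₁) ⋯ (∀^{𝔲ₙ} xₙ) (∀^𝔣 f) f(x₁, …, xₙ) ∈ S`. -/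
def extApp {X : Type u} {n : ℕ} (𝔲 : Fin n → Ultrafilter X)
    (𝔣 : Ultrafilter ((Fin n → X) → X)) : Ultrafilter X :=
  (tensor 𝔲).bind fun x => 𝔣.map fun f => f x

/-- The extension to ultrafilters of the membership predicate `in(x₁, …, xₙ, R)`:
it holds at `(𝔲₁, …, 𝔲ₙ, 𝔯)` iff `(∀^{𝔲₁} x₁) ⋯ (∀^{𝔲ₙ} xₙ) (∀^𝔯 R) R(x₁, …, xₙ)`. -/
def extIn {X : Type u} {n : ℕ} (𝔲 : Fin n → Ultrafilter X)
    (𝔯 : Ultrafilter (Set (Fin n → X))) : Prop :=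
  {x | {R | x ∈ R} ∈ 𝔯} ∈ tensor 𝔲

/-- An ultrafilter over `n`-ary operations on `X` is pseudo-principal iff `app̃` takes every tuple
of principal ultrafilters together with it to a principal ultrafilter. -/
def IsPseudoPrincipal {X : Type u} {n : ℕ} (𝔣 : Ultrafilter ((Fin n → X) → X)) : Prop :=
  ∀ a : Fin n → X, ∃ y : X, extApp (fun i => pure (a i)) 𝔣 = pure y

/-- `𝔄` is the principal submodel of the generalized model `𝔅` in the narrow sense: the submodel
of `𝔅` consisting of the principal ultrafilters, which are identified with the points of `X`. -/
def IsPrincipalSubmodel {L : Language} {X : Type u} (𝔄 : L.Structure X) (𝔅 : UltraInterp L X) :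
    Prop :=
  (∀ (n : ℕ) (f : L.Functions n) (a : Fin n → X),
    extApp (fun i => pure (a i)) (𝔅.funUlt f) = pure (𝔄.funMap f a)) ∧
  ∀ (n : ℕ) (R : L.Relations n) (a : Fin n → X),
    𝔄.RelMap R a ↔ extIn (fun i => pure (a i)) (𝔅.relUlt R)

/-- The map `I`, from generalized models in the narrow sense with the universe `βX` to generalized
models in the wide sense with the universe `βX`. An ultrafilter `𝔣` over the `n`-ary operations
on `X` goes to the ultrafilter over the `n`-ary operations on `βX` generated by the sets
`{f̃ | f ∈ A}` with `A ∈ 𝔣`; an ultrafilter `𝔯` over the `n`-ary relations on `X` goes to the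
ultrafilter over the `n`-ary relations on `βX` generated by the sets `{R* | R ∈ A}`
with `A ∈ 𝔯`. -/
def mapI {L : Language} {X : Type u} (𝔅 : UltraInterp L X) : UltraInterp L (Ultrafilter X) where
  funUlt f := (𝔅.funUlt f).map extMap
  relUlt R := (𝔅.relUlt R).map starRel

/-- An ordinary model regarded as a generalized model in the wide sense: every symbol is
interpreted by a principal ultrafilter. -/
def principalInterp {L : Language} {M : Type u} (𝔄 : L.Structure M) : UltraInterp L M where
  funUlt f := pure (𝔄.funMap f)
  relUlt R := pure {x | 𝔄.RelMap R x}

/-! ## Limits and homomorphisms of generalized models in the wide sense -/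

/-- The spaces in which limits of ultrafilters over `n`-ary operations and over `n`-ary relations
on `M` are taken: for each `n`, topologies on the sets of all `n`-ary operations and relations,
and the subspaces in which limits are sought. -/
structure LimitSpaces (M : Type u) where
  funTop : ∀ n : ℕ, TopologicalSpace ((Fin n → M) → M)
  funSpace : ∀ n : ℕ, Set ((Fin n → M) → M)
  relTop : ∀ n : ℕ, TopologicalSpace (Set (Fin n → M))
  relSpace : ∀ n : ℕ, Set (Set (Fin n → M))

/-- `z` is the limit of `𝔷` in the subspace `S`: the unique point of `S` to which `𝔷` converges. -/
def IsLimitIn {Z : Type u} (τ : TopologicalSpace Z) (S : Set Z) (𝔷 : Ultrafilter Z) (z : Z) :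
    Prop :=
  z ∈ S ∧ (𝔷 : Filter Z) ≤ @nhds Z τ z ∧ ∀ w ∈ S, (𝔷 : Filter Z) ≤ @nhds Z τ w → w = z

/-- `𝔄 = lim 𝔘`. -/
def IsLimitModel {L : Language} {M : Type u} (T : LimitSpaces M) (𝔘 : UltraInterp L M)
    (𝔄 : L.Structure M) : Prop :=
  (∀ (n : ℕ) (f : L.Functions n),
    IsLimitIn (T.funTop n) (T.funSpace n) (𝔘.funUlt f) (𝔄.funMap f)) ∧
  ∀ (n : ℕ) (R : L.Relations n),
    IsLimitIn (T.relTop n) (T.relSpace n) (𝔘.relUlt R) {x | 𝔄.RelMap R x}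

/-- `g` is a homomorphism of the generalized model `𝔘` into the generalized model `𝔙`: both models
have limits, and `g` is a homomorphism of `lim 𝔘` into `lim 𝔙`. -/
def IsGenHom {L : Language} {M : Type u} {N : Type v} (S : LimitSpaces M) (𝔘 : UltraInterp L M)
    (T : LimitSpaces N) (𝔙 : UltraInterp L N) (g : M → N) : Prop :=
  ∃ (𝔄 : L.Structure M) (ℭ : L.Structure N), IsLimitModel S 𝔘 𝔄 ∧ IsLimitModel T 𝔙 ℭ ∧
    ∃ φ : @Language.Hom L M N 𝔄 ℭ, φ.toFun = g

/-- Discrete topologies on all operations and relations. An ordinary model is the limit of the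
generalized model that it induces. -/
def discreteSpaces (M : Type u) : LimitSpaces M where
  funTop _ := ⊥
  funSpace _ := univ
  relTop _ := ⊥
  relSpace _ := univ

/-- An `n`-ary map `F` on `M` is right continuous w.r.t. `A`: it is continuous in its `i`-th
argument whenever the arguments before the `i`-th lie in `A`. The set of these maps
is `RC_A(Mⁿ, N)`. -/
def RightContinuous {M : Type u} {N : Type v} [TopologicalSpace M] [TopologicalSpace N] {n : ℕ}
    (A : Set M) (F : (Fin n → M) → N) : Prop :=
  ∀ (i : Fin n) (x : Fin n → M), (∀ j, j < i → x j ∈ A) →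
    Continuous fun t : M => F (Function.update x i t)

/-- `Q` is the closure of an open set. -/
def IsRegularClosed {Z : Type u} [TopologicalSpace Z] (Q : Set Z) : Prop :=
  ∃ U : Set Z, IsOpen U ∧ Q = closure U

/-- The topology on the subsets of `Z` that is the product topology on `2 ^ Z`, with `2`
discrete. -/
abbrev powersetTopology (Z : Type u) : TopologicalSpace (Set Z) :=
  ⨅ z : Z, TopologicalSpace.induced (fun S : Set Z => z ∈ S) ⊥

/-- The spaces in which the limit of `I(𝔅)` is taken: the right continuous operations on `βX`
w.r.t. `X` with the topology of pointwise convergence on `X ^ n`, and the regular closed relations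
on `βX` with the topology transferred from `2 ^ (X ^ n)` along the bijection `R ↦ R*`. -/
def standardSpaces (X : Type u) : LimitSpaces (Ultrafilter X) where
  funTop n := TopologicalSpace.induced
    (fun (G : (Fin n → Ultrafilter X) → Ultrafilter X) (a : Fin n → X) => G fun i => pure (a i))
    Pi.topologicalSpace
  funSpace _ := {G | RightContinuous (range (pure : X → Ultrafilter X)) G}
  relTop n := TopologicalSpace.coinduced starRel (powersetTopology (Fin n → X))
  relSpace _ := {Q | IsRegularClosed Q}

end

end UltraModel

namespace UltraModel

/-! ## The topology of ultrafilter extensions -/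

/-! The limit of `I(𝔅)` is `𝔄*` (`isLimitModel_mapI`), so (ii) and (iv) say the same thing. The
implication from (iv) to (iii) holds because `R̃ ⊆ R*`, and (iii) gives (i) by restriction to
principal ultrafilters, where both extensions agree with `𝔄`. The content is (i) to (iv). For
operations, both `h̃ ∘ F̃` and `G ∘ h̃` are right continuous w.r.t. the dense set `X` and agree on
it, and such maps are determined there (`RightContinuous.eq_of_eqOn`). For relations, `R*` is the
closure of `R` in `(βX)ⁿ`, so a continuous map sending `R` into a closed set sends `R*` there too.
The same two principles identify the limit: density makes a limit operation unique, and every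
regular closed set is `R*` for some `R`, so limits of relations can be computed in `2 ^ (X ^ n)`. -/

theorem continuous_ultrafilter_iff {W : Type*} {X : Type u} [TopologicalSpace W]
    {f : W → Ultrafilter X} :
    Continuous f ↔ ∀ A : Set X, IsOpen {w | A ∈ f w} := by
  rw [ultrafilterBasis_is_basis.continuous_iff]
  constructor
  · intro H A
    exact H _ ⟨A, rfl⟩
  · rintro H _ ⟨A, rfl⟩
    exact H A

theorem continuous_ultrafilter_map {X Z : Type u} (f : X → Z) :
    Continuous (Ultrafilter.map f) :=
  continuous_ultrafilter_iff.2 fun A => ultrafilter_isOpen_basic (f ⁻¹' A)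

theorem tensor_pure {X : Type u} {n : ℕ} (a : Fin n → X) :
    tensor (fun i => (pure (a i) : Ultrafilter X)) = pure a := by
  induction n with
  | zero => rw [Subsingleton.elim a Fin.elim0]; rfl
  | succ n ih =>
    ext A
    rw [mem_tensor_succ]
    have e : Fin.tail (fun i => (pure (a i) : Ultrafilter X)) = fun i => pure (Fin.tail a i) := rfl
    rw [e, ih, Ultrafilter.mem_pure, Ultrafilter.mem_pure, Set.mem_ofPred_eq, Ultrafilter.mem_pure,
      Set.mem_ofPred_eq, Fin.cons_self_tail]

theorem pi_mem_tensor {X : Type u} {n : ℕ} {𝔲 : Fin n → Ultrafilter X} {A : Fin n → Set X}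
    (hA : ∀ i, A i ∈ 𝔲 i) : {x | ∀ i, x i ∈ A i} ∈ tensor 𝔲 := by
  induction n with
  | zero => exact fun i => i.elim0
  | succ n ih =>
    rw [mem_tensor_succ]
    filter_upwards [hA 0] with x hx
    filter_upwards [ih (𝔲 := Fin.tail 𝔲) (A := Fin.tail A) fun i => hA i.succ] with y hy
    intro i
    refine Fin.cases ?_ ?_ i
    · simpa using hx
    · intro j
      rw [Fin.cons_succ]
      exact hy j

/-- Principal coordinates before the `i`-th are simply substituted into the set. The `i`-th
quantifier then becomes outermost, so the condition on `t` is membership of a fixed set in `t`,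
which is basic open. -/
theorem rightContinuous_tensor {X : Type u} {n : ℕ} (i : Fin n) (𝔲 : Fin n → Ultrafilter X)
    (h𝔲 : ∀ j, j < i → 𝔲 j ∈ range (pure : X → Ultrafilter X)) :
    Continuous fun t => tensor (Function.update 𝔲 i t) := by
  induction n with
  | zero => exact i.elim0
  | succ n ih =>
    rw [continuous_ultrafilter_iff]
    intro A
    induction i using Fin.cases with
    | zero =>
      simp only [mem_tensor_succ, Function.update_self, Fin.tail_update_zero]
      exact ultrafilter_isOpen_basic _
    | succ j =>
      obtain ⟨a, ha⟩ := h𝔲 0 (Fin.succ_pos j)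
      have e : ∀ t, A ∈ tensor (Function.update 𝔲 j.succ t) ↔
          {y | (Fin.cons a y : Fin (n + 1) → X) ∈ A} ∈
            tensor (Function.update (Fin.tail 𝔲) j t) := fun t => by
        rw [mem_tensor_succ, Function.update_of_ne (Fin.succ_ne_zero j).symm, ← ha,
          Ultrafilter.mem_pure, Fin.tail_update_succ, Set.mem_ofPred_eq]
      simp only [e]
      exact continuous_ultrafilter_iff.1
        (ih j (Fin.tail 𝔲) fun k hk => h𝔲 k.succ (Fin.succ_lt_succ_iff.2 hk)) _

theorem extMap_pure {X : Type u} {n : ℕ} (F : (Fin n → X) → X) (a : Fin n → X) :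
    extMap F (fun i => pure (a i)) = pure (F a) := by
  rw [extMap, tensor_pure, Ultrafilter.map_pure]

theorem rightContinuous_extMap {X : Type u} {n : ℕ} (F : (Fin n → X) → X) :
    RightContinuous (range (pure : X → Ultrafilter X)) (extMap F) :=
  fun i 𝔲 h𝔲 => (continuous_ultrafilter_map F).comp (rightContinuous_tensor i 𝔲 h𝔲)

/-- Maps that are right continuous w.r.t. a dense set are determined by their values on it. -/
theorem RightContinuous.eq_of_eqOn {M : Type u} {N : Type v} [TopologicalSpace M]
    [TopologicalSpace N] [T2Space N] {n : ℕ} {D : Set M} (hD : Dense D)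
    {F G : (Fin n → M) → N} (hF : RightContinuous D F) (hG : RightContinuous D G)
    (hFG : ∀ x : Fin n → M, (∀ i, x i ∈ D) → F x = G x) : F = G := by
  -- Downward induction on the number `k` of leading arguments required to lie in `D`: `k = n` is
  -- the hypothesis and `k = 0` is the claim. Each step frees the last required argument by density,
  -- and right continuity applies because all arguments before it are still in `D`.
  have key : ∀ k : ℕ, k ≤ n →
      ∀ x : Fin n → M, (∀ i : Fin n, (i : ℕ) < k → x i ∈ D) → F x = G x := by
    intro k hk
    induction hk using Nat.decreasingInduction with
    | self => exact fun x hx => hFG x fun i => hx i i.2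
    | of_succ k hk ih =>
      intro x hx
      let i : Fin n := ⟨k, hk⟩
      have hc := Continuous.ext_on hD (hF i x fun j hj => hx j hj) (hG i x fun j hj => hx j hj)
        (fun t ht => ih (Function.update x i t) fun j hj => by
          rcases eq_or_ne j i with rfl | hne
          · simpa using ht
          · rw [Function.update_of_ne hne]
            refine hx j (lt_of_le_of_ne (Nat.lt_succ_iff.1 hj) fun e => hne (Fin.ext e)))
      simpa using congrFun hc (x i)
  funext x
  exact key 0 n.zero_le x fun i hi => absurd hi (Nat.not_lt_zero _)

/-! ## The larger extension of a relation as a closure -/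

theorem pure_mem_starRel {X : Type u} {n : ℕ} {R : Set (Fin n → X)} {a : Fin n → X} :
    (fun i => (pure (a i) : Ultrafilter X)) ∈ starRel R ↔ a ∈ R := by
  constructor
  · intro H
    obtain ⟨x, hx, hxa⟩ := H (fun i => {a i}) fun i => Ultrafilter.mem_pure.2 rfl
    rwa [← (funext hxa : x = a)]
  · exact fun ha A hA => ⟨a, ha, fun i => Ultrafilter.mem_pure.1 (hA i)⟩

theorem pure_mem_extRel {X : Type u} {n : ℕ} {R : Set (Fin n → X)} {a : Fin n → X} :
    (fun i => (pure (a i) : Ultrafilter X)) ∈ extRel R ↔ a ∈ R := by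
  rw [extRel, Set.mem_ofPred_eq, tensor_pure, Ultrafilter.mem_pure]

theorem extRel_subset_starRel {X : Type u} {n : ℕ} (R : Set (Fin n → X)) :
    extRel R ⊆ starRel R := fun 𝔲 h𝔲 A hA => by
  obtain ⟨x, hx⟩ := (tensor 𝔲).nonempty_of_mem (inter_mem h𝔲 (pi_mem_tensor hA))
  exact ⟨x, hx.1, hx.2⟩

theorem starRel_injective {X : Type u} {n : ℕ} :
    Function.Injective (starRel : Set (Fin n → X) → Set (Fin n → Ultrafilter X)) := by
  intro R S hRS
  ext a
  rw [← pure_mem_starRel, hRS, pure_mem_starRel]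

theorem isClosed_starRel {X : Type u} {n : ℕ} (R : Set (Fin n → X)) : IsClosed (starRel R) := by
  -- Contrapositive form of the definition: whenever a box `A` misses `R`, some `A i` is not in `𝔲
  -- i`. Each resulting union is finite, hence closed.
  have e : starRel R = ⋂ A : Fin n → Set X, ⋂ _ : ¬ ∃ x ∈ R, ∀ i, x i ∈ A i,
      ⋃ i, {𝔲 : Fin n → Ultrafilter X | A i ∈ 𝔲 i}ᶜ := by
    ext 𝔲
    simp only [starRel, Set.mem_ofPred_eq, Set.mem_iInter, Set.mem_iUnion, Set.mem_compl_iff]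
    refine forall_congr' fun A => ?_
    rw [← not_forall, not_imp_not]
  rw [e]
  refine isClosed_iInter fun A => isClosed_iInter fun _ => isClosed_iUnion_of_finite fun i => ?_
  have ho : IsOpen {𝔲 : Fin n → Ultrafilter X | A i ∈ 𝔲 i} :=
    continuous_ultrafilter_iff.1 (continuous_apply i) (A i)
  exact ho.isClosed_compl

/-- A point outside `C` has a basic neighbourhood missing `C`, given by a box of sets `A i ∈ 𝔲 i`.
If the point were in `R*`, that box would contain a tuple of `R`, whose principal image lies in `C`.
-/
theorem starRel_subset_of_isClosed {X : Type u} {n : ℕ} {R : Set (Fin n → X)}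
    {C : Set (Fin n → Ultrafilter X)} (hC : IsClosed C)
    (hR : ∀ a ∈ R, (fun i => (pure (a i) : Ultrafilter X)) ∈ C) : starRel R ⊆ C := by
  intro 𝔲 h𝔲
  by_contra hn
  obtain ⟨U, hU, hUC⟩ := isOpen_pi_iff'.1 hC.isOpen_compl 𝔲 hn
  have hA : ∀ i, ∃ A ∈ 𝔲 i, {𝔳 : Ultrafilter X | A ∈ 𝔳} ⊆ U i := fun i => by
    obtain ⟨_, ⟨A, rfl⟩, hA, hAU⟩ :=
      ultrafilterBasis_is_basis.exists_subset_of_mem_open (hU i).2 (hU i).1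
    exact ⟨A, hA, hAU⟩
  choose A hA hAU using hA
  obtain ⟨a, haR, haA⟩ := h𝔲 A hA
  exact hUC (fun i _ => hAU i (Ultrafilter.mem_pure.2 (haA i))) (hR a haR)

theorem starRel_eq_closure {X : Type u} {n : ℕ} (R : Set (Fin n → X)) :
    starRel R = closure ((fun a i => (pure (a i) : Ultrafilter X)) '' R) := by
  refine Subset.antisymm ?_ ?_
  · exact starRel_subset_of_isClosed isClosed_closure
      fun a ha => subset_closure (mem_image_of_mem _ ha)
  · refine closure_minimal ?_ (isClosed_starRel R)
    rintro _ ⟨a, ha, rfl⟩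
    exact pure_mem_starRel.2 ha

theorem isOpen_singleton_pure {X : Type u} (x : X) :
    IsOpen {(pure x : Ultrafilter X)} := by
  have e : {(pure x : Ultrafilter X)} = {𝔲 | {x} ∈ 𝔲} := by
    ext 𝔲
    rw [Set.mem_singleton_iff, Set.mem_ofPred_eq]
    constructor
    · rintro rfl
      exact Ultrafilter.mem_pure.2 rfl
    · intro H
      exact Ultrafilter.coe_le_coe.1 (Filter.le_pure_iff.2 H)
  rw [e]
  exact ultrafilter_isOpen_basic _

theorem isOpen_image_pure {X : Type u} {n : ℕ} (R : Set (Fin n → X)) :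
    IsOpen ((fun a i => (pure (a i) : Ultrafilter X)) '' R) := by
  rw [← Set.biUnion_of_singleton ((fun a i => (pure (a i) : Ultrafilter X)) '' R), biUnion_image]
  refine isOpen_biUnion fun a _ => ?_
  rw [← Set.univ_pi_singleton]
  exact isOpen_set_pi finite_univ fun i _ => isOpen_singleton_pure _

theorem isRegularClosed_starRel {X : Type u} {n : ℕ} (R : Set (Fin n → X)) :
    IsRegularClosed (starRel R) :=
  ⟨_, isOpen_image_pure R, starRel_eq_closure R⟩

/-- Principal tuples are dense, so an open `U` has the same closure as its trace on them. This
surjectivity of `R ↦ R*` is what makes limits in the space of regular closed sets unique. -/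
theorem IsRegularClosed.exists_eq_starRel {X : Type u} {n : ℕ}
    {Q : Set (Fin n → Ultrafilter X)} (hQ : IsRegularClosed Q) :
    ∃ R : Set (Fin n → X), Q = starRel R := by
  obtain ⟨U, hU, rfl⟩ := hQ
  have hd : DenseRange (fun (a : Fin n → X) i => (pure (a i) : Ultrafilter X)) :=
    DenseRange.piMap fun _ => denseRange_pure
  refine ⟨(fun a i => (pure (a i) : Ultrafilter X)) ⁻¹' U, ?_⟩
  rw [starRel_eq_closure, Set.image_preimage_eq_inter_range]
  exact Subset.antisymm
    (closure_minimal (Dense.open_subset_closure_inter hd hU) isClosed_closure)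
    (closure_mono inter_subset_left)

/-! ## Limits -/

theorem isLimitModel_principalInterp {L : Language} {M : Type u} (𝔄 : L.Structure M) :
    IsLimitModel (discreteSpaces M) (principalInterp 𝔄) 𝔄 := by
  have key : ∀ {Z : Type u} (z : Z), IsLimitIn ⊥ univ (pure z) z := fun {Z} z => by
    let _ : TopologicalSpace Z := ⊥
    have : DiscreteTopology Z := ⟨rfl⟩
    refine ⟨mem_univ z, pure_le_nhds z, fun w _ hw => ?_⟩
    rw [nhds_discrete] at hw
    exact (Ultrafilter.mem_pure.1 (Filter.le_pure_iff.1 hw)).symm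
  exact ⟨fun n f => key _, fun n R => key _⟩

theorem IsLimitIn.unique {Z : Type u} {τ : TopologicalSpace Z} {S : Set Z} {𝔷 : Ultrafilter Z}
    {z w : Z} (hz : IsLimitIn τ S 𝔷 z) (hw : IsLimitIn τ S 𝔷 w) : z = w :=
  hw.2.2 z hz.1 hz.2.1

/-- Limits are unique, so the models hidden in the existential may be replaced by any known limits.
-/
theorem isGenHom_iff {L : Language} {M : Type u} {N : Type v} {S : LimitSpaces M}
    {𝔘 : UltraInterp L M} {T : LimitSpaces N} {𝔙 : UltraInterp L N} {g : M → N}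
    {𝔄 : L.Structure M} {ℭ : L.Structure N} (h𝔄 : IsLimitModel S 𝔘 𝔄)
    (hℭ : IsLimitModel T 𝔙 ℭ) :
    IsGenHom S 𝔘 T 𝔙 g ↔
      (∀ (n : ℕ) (f : L.Functions n) (x : Fin n → M),
        g (𝔄.funMap f x) = ℭ.funMap f (g ∘ x)) ∧
      ∀ (n : ℕ) (R : L.Relations n) (x : Fin n → M), 𝔄.RelMap R x → ℭ.RelMap R (g ∘ x) := by
  constructor
  · rintro ⟨𝔄', ℭ', h𝔄', hℭ', φ, rfl⟩
    refine ⟨fun n f x => ?_, fun n R x hx => ?_⟩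
    · rw [(h𝔄.1 n f).unique (h𝔄'.1 n f), (hℭ.1 n f).unique (hℭ'.1 n f)]
      exact φ.map_fun' f x
    · have h₁ := Set.ext_iff.1 ((h𝔄.2 n R).unique (h𝔄'.2 n R)) x
      have h₂ := Set.ext_iff.1 ((hℭ.2 n R).unique (hℭ'.2 n R)) (φ.toFun ∘ x)
      exact h₂.2 (φ.map_rel' R x (h₁.1 hx))
  · rintro ⟨hf, hR⟩
    exact ⟨𝔄, ℭ, h𝔄, hℭ, @Language.Hom.mk L M N 𝔄 ℭ g (fun {n} => hf n) (fun {n} => hR n), rfl⟩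

/-- Convergence is coordinatewise in discrete `2`, and an ultrafilter decides each coordinate: when
`z ∉ S` the condition concerns the complement of `{R | z ∈ R}`. -/
theorem le_nhds_powersetTopology_iff {Z : Type u} {𝔷 : Ultrafilter (Set Z)} {S : Set Z} :
    (𝔷 : Filter (Set Z)) ≤ @nhds _ (powersetTopology Z) S ↔
      ∀ z, {R | z ∈ R} ∈ 𝔷 ↔ z ∈ S := by
  rw [powersetTopology, nhds_iInf, le_iInf_iff]
  refine forall_congr' fun z => ?_
  rw [@nhds_induced _ _ ⊥, ← Filter.map_le_iff_le_comap]
  have e : @nhds Prop ⊥ (z ∈ S) = pure (z ∈ S) :=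
    congrFun (@nhds_discrete Prop ⊥ (@DiscreteTopology.mk Prop ⊥ rfl)) _
  rw [e, Filter.le_pure_iff, Filter.mem_map]
  by_cases hz : z ∈ S
  · have e' : (fun R : Set Z => z ∈ R) ⁻¹' {z ∈ S} = {R | z ∈ R} := by
      ext R; simp [hz]
    rw [e']
    simp [hz]
  · have e' : (fun R : Set Z => z ∈ R) ⁻¹' {z ∈ S} = {R | z ∈ R}ᶜ := by
      ext R; simp [hz]
    rw [e']
    simp only [hz, iff_false]
    exact Ultrafilter.compl_mem_iff_notMem

/-- Injectivity gives `s ⁻¹' (s '' U) = U`, so images of open sets are open in the coinduced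
topology and convergence can be pulled back. -/
theorem map_le_nhds_coinduced_iff {Z : Type u} {W : Type v} {τ : TopologicalSpace Z} {s : Z → W}
    (hs : Function.Injective s) {l : Filter Z} {z : Z} :
    l.map s ≤ @nhds W (τ.coinduced s) (s z) ↔ l ≤ 𝓝 z := by
  constructor
  · intro H
    rw [le_nhds_iff]
    intro U hz hU
    have hmem : s '' U ∈ @nhds W (τ.coinduced s) (s z) := by
      let _ := τ.coinduced s
      refine IsOpen.mem_nhds ?_ (mem_image_of_mem s hz)
      rw [isOpen_coinduced, hs.preimage_image]
      exact hU
    have := H hmem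
    rwa [Filter.mem_map, hs.preimage_image] at this
  · intro H
    let _ := τ.coinduced s
    exact (Filter.map_mono H).trans (continuous_coinduced_rng.tendsto z)

theorem extApp_pure {X : Type u} {n : ℕ} (a : Fin n → X) (𝔣 : Ultrafilter ((Fin n → X) → X)) :
    extApp (fun i => pure (a i)) 𝔣 = 𝔣.map fun f => f a := by
  ext S
  rw [extApp, tensor_pure]
  rfl

/-- At each `a` the values `f̃(a)` are principal, so the ultrafilter to test is the image under
`pure` of the ultrafilter of values `f a`. In `βX` such an image converges exactly to the
ultrafilter it came from, recovered by `joinM`. -/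
theorem le_nhds_standardSpaces_fun_iff {X : Type u} {n : ℕ}
    {𝔣 : Ultrafilter ((Fin n → X) → X)} {G : (Fin n → Ultrafilter X) → Ultrafilter X} :
    ((𝔣.map extMap : Ultrafilter _) : Filter _) ≤ @nhds _ ((standardSpaces X).funTop n) G ↔
      ∀ a : Fin n → X, G (fun i => pure (a i)) = extApp (fun i => pure (a i)) 𝔣 := by
  rw [standardSpaces, nhds_induced, ← Filter.map_le_iff_le_comap, nhds_pi, Filter.le_pi]
  refine forall_congr' fun a => ?_
  rw [extApp_pure]
  have hm : Filter.map (fun (H : (Fin n → X) → Ultrafilter X) => H a)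
      (Filter.map (fun (G : (Fin n → Ultrafilter X) → Ultrafilter X) (a : Fin n → X) =>
        G fun i => pure (a i)) ((𝔣.map extMap : Ultrafilter _) : Filter _)) =
      (((𝔣.map fun f => f a).map pure : Ultrafilter (Ultrafilter X)) : Filter _) := by
    simp only [Ultrafilter.coe_map, Filter.map_map]
    congr 1
    funext f
    exact extMap_pure f a
  rw [Filter.Tendsto, hm, ultrafilter_converges_iff]
  have hj : joinM ((𝔣.map fun f => f a).map (pure : X → Ultrafilter X)) = 𝔣.map fun f => f a := by
    ext S
    rfl
  rw [hj]

/-- The limit of `I(𝔅)` is the larger ultrafilter extension of the principal submodel of `𝔅`. -/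
theorem isLimitModel_mapI {L : Language} {X : Type u} {𝔄 : L.Structure X} {𝔅 : UltraInterp L X}
    (h𝔄 : IsPrincipalSubmodel 𝔄 𝔅) :
    IsLimitModel (standardSpaces X) (mapI 𝔅) (starModel 𝔄) := by
  have hin : ∀ (n : ℕ) (R : L.Relations n) (a : Fin n → X),
      {S | a ∈ S} ∈ 𝔅.relUlt R ↔ a ∈ {x | 𝔄.RelMap R x} := fun n R a => by
    rw [Set.mem_ofPred_eq, h𝔄.2 n R a, extIn, tensor_pure, Ultrafilter.mem_pure, Set.mem_ofPred_eq]
  refine ⟨fun n f => ⟨rightContinuous_extMap _, ?_, fun G hG hlim => ?_⟩,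
    fun n R => ⟨isRegularClosed_starRel _, ?_, fun Q hQ hlim => ?_⟩⟩
  · exact le_nhds_standardSpaces_fun_iff.2 fun a => (extMap_pure _ a).trans (h𝔄.1 n f a).symm
  · refine RightContinuous.eq_of_eqOn denseRange_pure hG (rightContinuous_extMap _) fun x hx => ?_
    choose a ha using hx
    obtain rfl : (fun i => pure (a i)) = x := funext ha
    rw [le_nhds_standardSpaces_fun_iff.1 hlim a, h𝔄.1 n f a]
    exact (extMap_pure _ a).symm
  · exact (map_le_nhds_coinduced_iff starRel_injective).2 (le_nhds_powersetTopology_iff.2 (hin n R))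
  · obtain ⟨S, rfl⟩ := hQ.exists_eq_starRel
    have hS := le_nhds_powersetTopology_iff.1 ((map_le_nhds_coinduced_iff starRel_injective).1 hlim)
    have : S = {x | 𝔄.RelMap R x} := Set.ext fun a => (hS a).symm.trans (hin n R a)
    rw [this]
    rfl

/-! ## Extending homomorphisms -/

theorem extend_pure {X : Type u} {Y : Type v} [TopologicalSpace Y] [T2Space Y] (h : X → Y)
    (x : X) : Ultrafilter.extend h (pure x) = h x :=
  congrFun (ultrafilter_extend_extends h) x

theorem extend_extMap {X : Type u} {Y : Type v} [TopologicalSpace Y] [CompactSpace Y] [T2Space Y]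
    {n : ℕ} {h : X → Y} {F : (Fin n → X) → X} {G : (Fin n → Y) → Y}
    (hG : RightContinuous (range h) G) (hFG : ∀ a, h (F a) = G (h ∘ a))
    (𝔲 : Fin n → Ultrafilter X) :
    Ultrafilter.extend h (extMap F 𝔲) = G (Ultrafilter.extend h ∘ 𝔲) := by
  refine congrFun (RightContinuous.eq_of_eqOn (F := fun 𝔲 => Ultrafilter.extend h (extMap F 𝔲))
    (G := fun 𝔲 => G (Ultrafilter.extend h ∘ 𝔲)) denseRange_pure ?_ ?_ ?_) 𝔲
  · exact fun i x hx =>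
      (continuous_ultrafilter_extend h).comp (rightContinuous_extMap F i x hx)
  -- `h̃` sends principal ultrafilters into `h``X`, which is exactly where the right continuity of
  -- `G` is available.
  · intro i x hx
    simp only [Function.comp_update]
    refine (hG i (Ultrafilter.extend h ∘ x) fun j hj => ?_).comp (continuous_ultrafilter_extend h)
    obtain ⟨a, ha⟩ := hx j hj
    exact ⟨a, by rw [Function.comp_apply, ← ha, extend_pure]⟩
  · intro x hx
    choose a ha using hx
    obtain rfl : (fun i => pure (a i)) = x := funext ha
    simp only [extMap_pure, extend_pure, hFG]
    congr 1
    funext i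
    exact (extend_pure h (a i)).symm

theorem extend_mem_of_mem_starRel {X : Type u} {Y : Type v} [TopologicalSpace Y] [CompactSpace Y]
    [T2Space Y] {n : ℕ} {h : X → Y} {R : Set (Fin n → X)} {S : Set (Fin n → Y)}
    (hS : IsClosed S) (hRS : ∀ a ∈ R, h ∘ a ∈ S) {𝔲 : Fin n → Ultrafilter X}
    (h𝔲 : 𝔲 ∈ starRel R) : Ultrafilter.extend h ∘ 𝔲 ∈ S := by
  have hc : Continuous fun 𝔲 : Fin n → Ultrafilter X => Ultrafilter.extend h ∘ 𝔲 :=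
    continuous_pi fun i => (continuous_ultrafilter_extend h).comp (continuous_apply i)
  refine starRel_subset_of_isClosed (hS.preimage hc) (fun a ha => ?_) h𝔲
  have e : Ultrafilter.extend h ∘ (fun i => pure (a i)) = h ∘ a :=
    funext fun i => extend_pure h (a i)
  rw [Set.mem_preimage, e]
  exact hRS a ha

end UltraModel

theorem mainTheorem2 {L : FirstOrder.Language} {X : Type u} {Y : Type v}
    [TopologicalSpace Y] [CompactSpace Y] [T2Space Y]
    (𝔘 : UltraModel.UltraInterp L (Ultrafilter X))
    (𝔙 : UltraModel.UltraInterp L Y) (T : UltraModel.LimitSpaces Y)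
    (h : X → Y)
    -- `𝔘 = I(𝔅)`, with `𝔅` pseudo-principal on function symbols and `𝔄` its principal submodel
    (𝔅 : UltraModel.UltraInterp L X) (h𝔘 : 𝔘 = UltraModel.mapI 𝔅)
    (h𝔅 : ∀ (n : ℕ) (f : L.Functions n), UltraModel.IsPseudoPrincipal (𝔅.funUlt f))
    (𝔄 : L.Structure X) (h𝔄 : UltraModel.IsPrincipalSubmodel 𝔄 𝔅)
    -- the limits of the interpretations of the symbols in `𝔙`
    (hfun : ∀ (n : ℕ) (f : L.Functions n), ∃ G : (Fin n → Y) → Y,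
      UltraModel.IsLimitIn (T.funTop n) (T.funSpace n) (𝔙.funUlt f) G ∧
        UltraModel.RightContinuous (Set.range h) G)
    (hrel : ∀ (n : ℕ) (R : L.Relations n), ∃ S : Set (Fin n → Y),
      UltraModel.IsLimitIn (T.relTop n) (T.relSpace n) (𝔙.relUlt R) S ∧ IsClosed S) :
    List.TFAE [
      UltraModel.IsGenHom (UltraModel.discreteSpaces X) (UltraModel.principalInterp 𝔄) T 𝔙 h,
      UltraModel.IsGenHom (UltraModel.standardSpaces X) 𝔘 T 𝔙 (Ultrafilter.extend h),
      UltraModel.IsGenHom (UltraModel.discreteSpaces (Ultrafilter X))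
        (UltraModel.principalInterp (UltraModel.tildeModel 𝔄)) T 𝔙 (Ultrafilter.extend h),
      UltraModel.IsGenHom (UltraModel.discreteSpaces (Ultrafilter X))
        (UltraModel.principalInterp (UltraModel.starModel 𝔄)) T 𝔙 (Ultrafilter.extend h)] := by
  open UltraModel in
  subst h𝔘
  choose G hG hGc using hfun
  choose S hS hSc using hrel
  -- The limit of `𝔙`, assembled symbol by symbol from the given limits.
  let ℭ : L.Structure Y := ⟨fun {n} f => G n f, fun {n} R x => x ∈ S n R⟩
  have hℭ : IsLimitModel T 𝔙 ℭ := ⟨hG, hS⟩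
  rw [isGenHom_iff (isLimitModel_principalInterp 𝔄) hℭ, isGenHom_iff (isLimitModel_mapI h𝔄) hℭ,
    isGenHom_iff (isLimitModel_principalInterp (tildeModel 𝔄)) hℭ,
    isGenHom_iff (isLimitModel_principalInterp (starModel 𝔄)) hℭ]
  -- Both limits are `starModel 𝔄`, so after the rewriting the two statements coincide.
  tfae_have 2 ↔ 4 := Iff.rfl
  tfae_have 1 → 4 := fun H =>
    ⟨fun n f => extend_extMap (hGc n f) (H.1 n f),
      fun n R _ h𝔲 => extend_mem_of_mem_starRel (hSc n R) (H.2 n R) h𝔲⟩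
  tfae_have 4 → 3 := fun H =>
    ⟨H.1, fun n R 𝔲 h𝔲 => H.2 n R 𝔲 (extRel_subset_starRel _ h𝔲)⟩
  tfae_have 3 → 1 := fun H => by
    have e : ∀ {n : ℕ} (a : Fin n → X),
        Ultrafilter.extend h ∘ (fun i => pure (a i)) = h ∘ a :=
      fun a => funext fun i => extend_pure h (a i)
    refine ⟨fun n f a => ?_, fun n R a ha => ?_⟩
    · have := H.1 n f fun i => pure (a i)
      rw [e] at this
      rw [← this, ← extend_pure h]
      exact congrArg _ (extMap_pure _ a).symm
    · have := H.2 n R (fun i => pure (a i)) (pure_mem_extRel.2 ha)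
      rwa [e] at this
  tfae_finish
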